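/- Fix $d\ge 1$. A *box* in $\mathbb{R}^d$ is a set $[a_1,b_1]\times\dots\times[a_d,b_d]$ with integers $a_i<b_i$; its side lengths are the $b_i-a_i$, its center is the point with coordinates $(a_i+b_i)/2$, and it is a *square box* if all its side lengths are equal. A *partition* is a finite collection $\mathcal C$ of boxes with pairwise disjoint interiors whose union is $[0,n]^d$ for some integer $n>0$; it is *cubical* if all its boxes are square boxes. For $0<\varepsilon<2/d$ put $T_\varepsilon x=\bigl(x_1-\tfrac{\varepsilon}{2}\sum_j x_j,\dots,x_d-\tfrac{\varepsilon}{2}\sum_j x_j\bigr)$. The *distortion* of a unit box $z+[0,1]^d$, $z\in\mathbb{Z}^d$, is the Voronoi cell of the site $T_\varepsilon\bigl(z+(\tfrac12,\dots,\tfrac12)\bigr)$ in the Voronoi diagram of the set of sites $\{T_\varepsilon(z'+(\tfrac12,\dots,\tfrac12)) : z'\in\mathbb{Z}^d\}$, and the distortion of a box is the union of the distortions of the unit boxes contained in it. The *dual complex* $D_\varepsilon(\mathcal C)$ is the nerve of the distorted boxes: its vertices are the boxes of $\mathcal C$, and a nonempty set of boxes is a simplex if and only if their distortions have a common point. For $\beta\ge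 1$, $\mathcal C$ is *$\beta$-balanced* (with respect to $\varepsilon$) if for every simplex $\sigma$ of $D_\varepsilon(\mathcal C)$ the longest side length among all boxes of $\sigma$ divided by the shortest side length among all boxes of $\sigma$ is at most $\beta$. $\mathcal C$ is *center-embeddable* (with respect to $\varepsilon$) if the map from the geometric realization of $D_\varepsilon(\mathcal C)$ to $\mathbb{R}^d$ that sends each vertex to the center of its box and is affine on each simplex is injective. **Theorem.** For every integer $d\ge 3$ and every real $\beta>\frac{d}{d-2}$ there exists a cubical partition $\mathcal C$ in $\mathbb{R}^d$ such that, for every $\varepsilon\in(0,2/d)$, $\mathcal C$ is $\beta$-balanced and is not center-embeddable. -/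

import Mathlib

namespace CubicalDual

/-- An integral hyper-rectangle `[lo₁, hi₁] × ⋯ × [lo_d, hi_d]` with integer `lo i < hi i`. -/
@[ext]
structure Box (d : ℕ) where
  lo : Fin d → ℤ
  hi : Fin d → ℤ
  lo_lt_hi : ∀ i, lo i < hi i

namespace Box

variable {d : ℕ}

/-- The closed point set in `ℝ^d` that a box describes. -/
def toSet (R : Box d) : Set (EuclideanSpace ℝ (Fin d)) :=
  {x | ∀ i, (R.lo i : ℝ) ≤ x i ∧ x i ≤ (R.hi i : ℝ)}

/-- The side length of a box in direction `i`. -/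
def length (R : Box d) (i : Fin d) : ℝ := (R.hi i : ℝ) - (R.lo i : ℝ)

/-- A square box: all side lengths are equal. -/
def IsSquare (R : Box d) : Prop := ∀ i j, R.length i = R.length j

/-- The center of a box. -/
noncomputable def center (R : Box d) : EuclideanSpace ℝ (Fin d) :=
  WithLp.toLp 2 fun i => ((R.lo i : ℝ) + (R.hi i : ℝ)) / 2

/-- The unit box `[z₁, z₁ + 1] × ⋯ × [z_d, z_d + 1]`. -/
def pixel (z : Fin d → ℤ) : Box d where
  lo := z
  hi := fun i => z i + 1
  lo_lt_hi := fun i => lt_add_one (z i)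

end Box

variable {d : ℕ}

/-- The square box `[0, n]^d`, as a point set. -/
def bigCube (d n : ℕ) : Set (EuclideanSpace ℝ (Fin d)) :=
  {x | ∀ i, 0 ≤ x i ∧ x i ≤ (n : ℝ)}

/-- A hyper-rectangular partition of `[0, n]^d`: finitely many boxes with pairwise disjoint
interiors whose union is `[0, n]^d`. -/
structure IsPartition (n : ℕ) (C : Finset (Box d)) : Prop where
  iUnion_eq : ⋃ R ∈ C, R.toSet = bigCube d n
  disjoint : ∀ R ∈ C, ∀ R' ∈ C, R ≠ R' → Disjoint (interior R.toSet) (interior R'.toSet)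

/-- A partition is cubical if all its boxes are square boxes. -/
def IsCubical (C : Finset (Box d)) : Prop := ∀ R ∈ C, R.IsSquare

/-- The distortion `T_ε x = (x₁ - ε (∑ xⱼ) / 2, …, x_d - ε (∑ xⱼ) / 2)`. -/
noncomputable def distort (ε : ℝ) (x : EuclideanSpace ℝ (Fin d)) : EuclideanSpace ℝ (Fin d) :=
  WithLp.toLp 2 fun i => x i - ε * ((∑ j, x j) / 2)

/-- The distorted pixel: the Voronoi cell of the distorted center of the pixel at `z`, among the
distorted centers of all pixels of `ℝ^d`. -/
def distortedPixel (ε : ℝ) (z : Fin d → ℤ) : Set (EuclideanSpace ℝ (Fin d)) :=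
  {x | ∀ z' : Fin d → ℤ,
    dist x (distort ε (Box.pixel z).center) ≤ dist x (distort ε (Box.pixel z').center)}

/-- The distorted box: the union of the distortions of all pixels contained in the box. -/
def distortedBox (ε : ℝ) (R : Box d) : Set (EuclideanSpace ℝ (Fin d)) :=
  {x | ∃ z : Fin d → ℤ, (Box.pixel z).toSet ⊆ R.toSet ∧ x ∈ distortedPixel ε z}

/-- The dual complex: the nerve of the distorted boxes. A vertex is a box of `C`; a nonempty set of
boxes of `C` is a simplex if the distorted boxes have a common point. -/
def dualComplex (ε : ℝ) (C : Finset (Box d)) : PreAbstractSimplicialComplex (Box d) where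
  faces := {σ | σ.Nonempty ∧ σ ⊆ C ∧ (⋂ R ∈ σ, distortedBox ε R).Nonempty}
  isRelLowerSet_faces := by
    rintro σ ⟨hne, hC, x, hx⟩
    refine ⟨hne, fun τ hτ hτne => ⟨hτne, hτ.trans hC, x, ?_⟩⟩
    simp only [Set.mem_iInter] at hx ⊢
    exact fun R hR => hx R (hτ hR)

/-- The balance of a set of boxes: the length of the longest side among all its boxes divided by
the length of the shortest side among all its boxes. -/
noncomputable def balance (σ : Finset (Box d)) : ℝ :=
  sSup {l : ℝ | ∃ R ∈ σ, ∃ i, R.length i = l} / sInf {l : ℝ | ∃ R ∈ σ, ∃ i, R.length i = l}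

/-- `β`-balanced: every simplex of the dual complex has balance at most `β`. -/
def IsBalanced (ε β : ℝ) (C : Finset (Box d)) : Prop :=
  ∀ σ ∈ (dualComplex ε C).faces, balance σ ≤ β

/-- The geometric realization of an abstract simplicial complex, in barycentric coordinates. -/
def realization {V : Type*} (K : PreAbstractSimplicialComplex V) : Set (V →₀ ℝ) :=
  {w | (∀ v, 0 ≤ w v) ∧ (w.sum fun _ t => t) = 1 ∧ w.support ∈ K.faces}

/-- A placement `π` of the vertices is an embedding of `K` if its extension to the geometric
realization, affine on each simplex, is injective. -/
def IsEmbeddingOf {V : Type*} (K : PreAbstractSimplicialComplex V)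
    (π : V → EuclideanSpace ℝ (Fin d)) : Prop :=
  Set.InjOn (fun w : V →₀ ℝ => w.sum fun v t => t • π v) (realization K)

/-- `C` is center-embeddable if placing each vertex of the dual complex at the center of its box
gives an embedding. -/
def CenterEmbeddable (ε : ℝ) (C : Finset (Box d)) : Prop :=
  IsEmbeddingOf (dualComplex ε C) Box.center

end CubicalDual

namespace CubicalDual
variable {d : ℕ}

/-! Cut space at a lattice corner `o` into d+1 regions: region k < d is where coordinate k is the
first one not below `o`, and region d lies below `o` in every coordinate. Tile region k by a grid of
mesh L_k, with the meshes pairwise coprime. By the Chinese remainder theorem `o` can be chosen so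
that the walls of each region are grid planes and, in the free directions j > k, the cell of region
k at the corner ends at o_j + 1. That cell then has center about o - (L_k/2)(1,…,1) + L_k e_k for k
< d, while the small cube P of side s in region d has center o - (s/2)(1,…,1).

If the large meshes are all about L, the d large centers lie near the hyperplane Σ(x_j - o_j) =
-(d-2)L/2, and the center of P has Σ(x_j - o_j) = -ds/2. It therefore crosses to the upper side once
L/s > d/(d-2). Let Q be the neighbor of the region-0 cell in the last direction; its center is also
on the upper side. The d large cells form a simplex with P and also with Q, so two simplices on a
common face have apexes on the same side and their images overlap.

Both simplices come from maximal chains of pixels, whose distorted cells share a point for every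
admissible ε (`exists_forall_mem_distortedPixel`), so one partition serves all ε.
`exists_affine_weights` makes the crossing exact, including the unit offsets and the unequal meshes.
-/

/-! ### Overlapping simplices -/

/-- If a vertex `P` beyond a simplex `B` is an affine combination of `B` and of another apex `Q` on
the same side, then the simplices `B ∪ {P}` and `B ∪ {Q}` overlap. -/
theorem not_isEmbeddingOf_of_overlap {V ι : Type*} [Fintype ι] [Nonempty ι] [DecidableEq V]
    (K : PreAbstractSimplicialComplex V) (π : V → EuclideanSpace ℝ (Fin d)) (B : ι → V) (P Q : V)
    (hP : insert P (Finset.univ.image B) ∈ K.faces) (hQ : insert Q (Finset.univ.image B) ∈ K.faces)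
    (hPQ : P ≠ Q) (hPB : ∀ i, B i ≠ P) (a : ι → ℝ) (μ : ℝ) (hμ : 0 ≤ μ) (ha : ∑ i, a i + μ = 1)
    (hπ : π P = ∑ i, a i • π (B i) + μ • π Q) : ¬ IsEmbeddingOf K π := by
  classical
  have key : ∀ (R : V) (b : ι → ℝ) (e : ℝ), insert R (Finset.univ.image B) ∈ K.faces →
      (∀ i, 0 ≤ b i) → 0 ≤ e → ∑ i, b i + e = 1 →
      (∑ i, Finsupp.single (B i) (b i) + Finsupp.single R e) ∈ realization K ∧
      ((∑ i, Finsupp.single (B i) (b i) + Finsupp.single R e).sum fun v t => t • π v)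
        = ∑ i, b i • π (B i) + e • π R := by
    intro R b e hR hb he hsum
    have hs : ((∑ i, Finsupp.single (B i) (b i) + Finsupp.single R e).sum fun _ t => t) = 1 := by
      rw [Finsupp.sum_add_index' (by simp) (by simp), ← Finsupp.sum_finsetSum_index (by simp) (by simp)]
      simp [Finsupp.sum_single_index, hsum]
    refine ⟨⟨fun v => ?_, hs, ?_⟩, ?_⟩
    · simp only [Finsupp.add_apply, Finsupp.finsetSum_apply, Finsupp.single_apply]
      refine add_nonneg (Finset.sum_nonneg fun i _ => ?_) ?_ <;> split_ifs <;> simp [hb, he]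
    · refine (K.isRelLowerSet_faces hR).2 ?_ ?_
      · refine Finsupp.support_add.trans (Finset.union_subset ?_ ?_)
        · refine Finsupp.support_finsetSum.trans (Finset.biUnion_subset.2 fun i _ => ?_)
          exact Finsupp.support_single_subset.trans (by simp)
        · exact Finsupp.support_single_subset.trans (by simp)
      · rw [Finset.nonempty_iff_ne_empty]
        intro h0
        rw [Finsupp.support_eq_empty] at h0
        simp [h0] at hs
    · rw [Finsupp.sum_add_index' (by simp) (by simp [add_smul]),
        ← Finsupp.sum_finsetSum_index (by simp) (by simp [add_smul])]
      simp [Finsupp.sum_single_index]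
  -- Start from a point of the first simplex with small weight t on P and weight Mt on each vertex
  -- of B. Replacing P by its affine expression keeps every weight nonnegative, since M dominates
  -- all |a i|; t normalizes the total to 1.
  set M : ℝ := ∑ i, |a i| + 1
  have hM : ∀ i, |a i| ≤ M := fun i =>
    (Finset.single_le_sum (f := fun i => |a i|) (fun _ _ => abs_nonneg _)
      (Finset.mem_univ i)).trans (by simp [M])
  have hM0 : 0 < M := by positivity
  set t : ℝ := 1 / (1 + Fintype.card ι * M)
  have ht : 0 < t := by positivity
  have hts : (Fintype.card ι : ℝ) * (M * t) + t = 1 := by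
    simp only [t]; field_simp; ring
  obtain ⟨h1, e1⟩ := key P (fun _ => M * t) t hP (fun _ => by positivity) ht.le
    (by simpa using hts)
  obtain ⟨h2, e2⟩ := key Q (fun i => M * t + t * a i) (t * μ) hQ
    (fun i => by nlinarith [neg_abs_le (a i), hM i]) (by positivity)
    (by
      rw [Finset.sum_add_distrib, ← Finset.mul_sum Finset.univ a, add_assoc, ← mul_add, ha]
      simpa using hts)
  intro hinj
  have heq := hinj h1 h2 (by
    simp only [e1, e2]
    rw [hπ]
    simp only [add_smul, Finset.sum_add_distrib, smul_add, Finset.smul_sum, smul_smul]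
    abel)
  have := DFunLike.congr_fun heq P
  simp [hPB, hPQ.symm] at this
  exact ht.ne' this

/-! ### Common points of distorted pixels -/

theorem sq_sub_mul_nonneg_of_abs_le_one (v τ : ℤ) (h : |τ| ≤ 1) : 0 ≤ v ^ 2 - τ * v := by
  have h' := abs_le.1 h
  obtain rfl | hv | hv : v = 0 ∨ 1 ≤ v ∨ v ≤ -1 := by omega
  · simp
  · nlinarith
  · nlinarith

/-- The squared length of a distorted vector as a quadratic form. -/
theorem norm_distort_sq (ε : ℝ) (x : EuclideanSpace ℝ (Fin d)) :
    ‖distort ε x‖ ^ 2 = (1 - ε * (1 - ε * d / 4) * d) * ∑ i, x i ^ 2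
      + ε * (1 - ε * d / 4) / 2 * ∑ i, ∑ j, (x i - x j) ^ 2 := by
  have h1 : ∑ i, ∑ j, (x i - x j) ^ 2 = 2 * d * ∑ i, x i ^ 2 - 2 * (∑ i, x i) ^ 2 := by
    simp only [sub_sq, Finset.sum_add_distrib, Finset.sum_sub_distrib, Finset.sum_const,
      Finset.card_univ, Fintype.card_fin, nsmul_eq_mul, ← Finset.mul_sum, ← Finset.sum_mul]
    ring
  have h2 : ‖distort ε x‖ ^ 2 = ∑ i, x i ^ 2 - ε * (1 - ε * d / 4) * (∑ i, x i) ^ 2 := by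
    rw [EuclideanSpace.norm_sq_eq]
    simp only [distort, Real.norm_eq_abs, sq_abs, sub_sq, Finset.sum_add_distrib,
      Finset.sum_sub_distrib, Finset.sum_const, Finset.card_univ, Fintype.card_fin, nsmul_eq_mul,
      ← Finset.mul_sum, ← Finset.sum_mul]
    ring
  rw [h1, h2]; ring

theorem distort_surjective {ε : ℝ} (h : ε * d ≠ 2) :
    Function.Surjective (distort ε : EuclideanSpace ℝ (Fin d) → _) := by
  intro g
  have h' : 2 - ε * d ≠ 0 := fun h0 => h (by linarith)
  refine ⟨WithLp.toLp 2 fun i => g i + ε / (2 - ε * d) * ∑ j, g j, ?_⟩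
  ext i
  simp only [distort, Finset.sum_add_distrib, Finset.sum_const, Finset.card_univ,
    Fintype.card_fin, nsmul_eq_mul]
  field_simp
  ring

/-- The distortion is self-adjoint. With surjectivity, this realizes any linear form in y as x ↦ ⟨z,
T_ε y⟩ for a suitable z. -/
theorem inner_distort (ε : ℝ) (x y : EuclideanSpace ℝ (Fin d)) :
    inner ℝ x (distort ε y) = ∑ i, distort ε x i * y i := by
  simp only [PiLp.inner_apply, distort, RCLike.inner_apply, conj_trivial, sub_mul,
    Finset.sum_sub_distrib, ← Finset.mul_sum]
  congr 1
  · exact Finset.sum_congr rfl fun _ _ => mul_comm _ _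
  · ring

theorem distort_sub (ε : ℝ) (x y : EuclideanSpace ℝ (Fin d)) :
    distort ε (x - y) = distort ε x - distort ε y := by
  ext i
  simp only [distort, PiLp.sub_apply, Finset.sum_sub_distrib]
  ring

/-- The distorted pixels of a maximal chain from `w` to `w + 1` (in which the coordinates are
increased in the order of decreasing `ρ`) have a common point. -/
theorem exists_forall_mem_distortedPixel {ε : ℝ} (h0 : 0 < ε) (h1 : ε * d < 2) (w : Fin d → ℤ)
    (ρ : Fin d → ℤ) (hρ : Function.Injective ρ) :
    ∃ x, ∀ z : Fin d → ℤ, (∀ i, z i = w i ∨ z i = w i + 1) →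
      (∀ i j, ρ j < ρ i → z j - w j ≤ z i - w i) → x ∈ distortedPixel ε z := by
  set c : ℝ := ε * (1 - ε * d / 4)
  have hc : 0 ≤ c := mul_nonneg h0.le (by linarith)
  have hα : 0 ≤ 1 - c * d := by
    have : 1 - c * d = (1 - ε * d / 2) ^ 2 := by simp only [c]; ring
    rw [this]; positivity
  set τ : Fin d → Fin d → ℤ := fun i j => (ρ i - ρ j).sign
  have hτ : ∀ i j, τ j i = - τ i j := fun i j => by
    simp only [τ]; rw [← Int.sign_neg, neg_sub]
  -- This y gives the squared distance exactly the linear part that completes each square in `F` to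
  -- v² - τv, a form that is nonnegative for integer v and |τ| ≤ 1.
  obtain ⟨y, hy⟩ := distort_surjective h1.ne (WithLp.toLp 2 fun i : Fin d =>
    (1 - c * d) / 2 + c / 2 * ∑ j, (τ i j : ℝ))
  set F : (Fin d → ℤ) → ℝ := fun z => (1 - c * d) * ∑ i, (((z i - w i) ^ 2 - 1 * (z i - w i) : ℤ) : ℝ)
    + c / 2 * ∑ i, ∑ j, ((((z i - w i) - (z j - w j)) ^ 2
        - τ i j * ((z i - w i) - (z j - w j)) : ℤ) : ℝ)
  have key : ∀ z, dist (distort ε (Box.pixel w).center + y) (distort ε (Box.pixel z).center) ^ 2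
      = ‖y‖ ^ 2 + F z := by
    intro z
    set u : EuclideanSpace ℝ (Fin d) := WithLp.toLp 2 fun i => ((z i - w i : ℤ) : ℝ)
    have hu : (Box.pixel z).center - (Box.pixel w).center = u := by
      ext i
      simp only [Box.center, Box.pixel, u, PiLp.sub_apply]
      push_cast; ring
    rw [dist_eq_norm, add_sub_right_comm, ← distort_sub, ← neg_sub, hu, ← zero_sub, distort_sub]
    have hz : distort ε (0 : EuclideanSpace ℝ (Fin d)) = 0 := by ext i; simp [distort]
    have hn : ‖distort ε u‖ ^ 2 = (1 - c * d) * ∑ i, u i ^ 2 + c / 2 * ∑ i, ∑ j, (u i - u j) ^ 2 :=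
      norm_distort_sq ε u
    rw [hz, zero_sub, neg_add_eq_sub, norm_sub_sq_real, hn, inner_distort, hy]
    have hskew : ∑ i, ∑ j, (τ i j : ℝ) * (u i - u j) = 2 * ∑ i, (∑ j, (τ i j : ℝ)) * u i := by
      simp only [mul_sub, Finset.sum_sub_distrib, two_mul, ← Finset.sum_mul]
      rw [Finset.sum_comm (f := fun i j => (τ i j : ℝ) * u j), sub_eq_add_neg,
        ← Finset.sum_neg_distrib]
      congr 1
      refine Finset.sum_congr rfl fun i _ => ?_
      rw [Finset.sum_mul, ← Finset.sum_neg_distrib]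
      refine Finset.sum_congr rfl fun j _ => ?_
      rw [hτ i j]; push_cast; ring
    have hF : F z = (1 - c * d) * ∑ i, (u i ^ 2 - u i)
        + c / 2 * ∑ i, ∑ j, ((u i - u j) ^ 2 - (τ i j : ℝ) * (u i - u j)) := by
      simp [F, u]
    rw [hF]
    simp only [Finset.sum_sub_distrib, hskew]
    simp only [add_mul, Finset.sum_add_distrib, mul_assoc, ← Finset.mul_sum]
    ring
  refine ⟨distort ε (Box.pixel w).center + y, fun z hz hz' z' => ?_⟩
  refine le_of_sq_le_sq ?_ dist_nonneg
  rw [key, key]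
  -- On the chain each increment is 0 or 1 and each difference of increments is 0 or τ, so every
  -- summand vanishes and z minimizes the distance.
  have hFz : F z = 0 := by
    have e1 : ∀ i, (z i - w i) ^ 2 - 1 * (z i - w i) = 0 := fun i => by
      rcases hz i with h | h <;> rw [h] <;> ring
    have e2 : ∀ i j, ((z i - w i) - (z j - w j)) ^ 2
        - τ i j * ((z i - w i) - (z j - w j)) = 0 := fun i j => by
      rcases lt_trichotomy (ρ i) (ρ j) with h | h | h
      · have := hz' j i h
        have ht : τ i j = -1 := Int.sign_eq_neg_one_of_neg (by omega)
        rw [ht]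
        have hv : z i - w i - (z j - w j) = 0 ∨ z i - w i - (z j - w j) = -1 := by
          have := hz i
          have := hz j
          omega
        rcases hv with hv | hv <;> rw [hv] <;> ring
      · rw [hρ h]; ring
      · have := hz' i j h
        have ht : τ i j = 1 := Int.sign_eq_one_of_pos (by omega)
        rw [ht]
        have hv : z i - w i - (z j - w j) = 0 ∨ z i - w i - (z j - w j) = 1 := by
          have := hz i
          have := hz j
          omega
        rcases hv with hv | hv <;> rw [hv] <;> ring
    simp only [F, e1, e2]; simp
  have hF : 0 ≤ F z' := by
    have hs : ∀ i j, |τ i j| ≤ 1 := fun i j => by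
      simp only [τ]
      rcases lt_trichotomy (ρ i - ρ j) 0 with h | h | h
      · rw [Int.sign_eq_neg_one_of_neg h]; simp
      · rw [h]; simp
      · rw [Int.sign_eq_one_of_pos h]; simp
    refine add_nonneg (mul_nonneg hα (Finset.sum_nonneg fun i _ => ?_))
      (mul_nonneg (by positivity) (Finset.sum_nonneg fun i _ => Finset.sum_nonneg fun j _ => ?_))
    · exact Int.cast_nonneg (sq_sub_mul_nonneg_of_abs_le_one _ _ (by simp))
    · exact Int.cast_nonneg (sq_sub_mul_nonneg_of_abs_le_one _ _ (hs i j))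
  linarith
-- Affine weights and choice of side lengths
section
open Finset

/-- The affine dependence between the centers of a cube and of larger cubes around its corner. -/
theorem exists_affine_weights (m : ℕ) (L : ℕ → ℝ) (s : ℝ) (hm : 1 ≤ m) (hs : 0 ≤ s)
    (hL1 : 1 ≤ L 0) (hL : Monotone L)
    (h : s * (m + 1) + (m + 1) * m < L 0 * (m - 1)) :
    ∃ (a : ℕ → ℝ) (μ : ℝ), 0 < μ ∧ ∑ k ∈ range (m + 1), a k = 1 ∧
      ∀ j ≤ m, -s / 2 = -(∑ k ∈ range (m + 1), a k * L k) / 2 + a j * L j + ∑ k ∈ range j, a k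
        + if j = m then μ else 0 := by
  have hL0 : ∀ k, 1 ≤ L k := fun k => hL1.trans (hL (Nat.zero_le k))
  -- The equations for j < m say a_j L_j + Σ_{k<j} a_k = t with t constant. Hence t - Σ_{k<j} a_k
  -- shrinks by the factor 1 - 1/L_j at each step and equals t r_j.
  set r : ℕ → ℝ := fun k => ∏ i ∈ range k, (1 - 1 / L i)
  have hf : ∀ i, 0 ≤ 1 - 1 / L i := fun i => by
    have : 1 / L i ≤ 1 := by rw [div_le_one (by linarith [hL0 i])]; exact hL0 i
    linarith
  have hr0 : ∀ k, 0 ≤ r k := fun k => prod_nonneg fun i _ => hf i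
  have hstep : ∀ k, r k / L k = r k - r (k + 1) := fun k => by
    simp only [r, prod_range_succ]; ring
  have hanti : Antitone r := antitone_nat_of_succ_le fun k => by
    have : 0 ≤ r k / L k := div_nonneg (hr0 k) (by linarith [hL0 k])
    linarith [hstep k]
  have hr1 : ∀ k, r k ≤ 1 := fun k => by simpa [r] using hanti (Nat.zero_le k)
  have htel : ∀ j, ∑ k ∈ range j, r k / L k = 1 - r j := fun j => by
    simp only [hstep, sum_range_sub']; simp [r]
  set X := L m * (1 - r m) with hX
  set Y := ∑ k ∈ range m, r k
  have hLm := hL0 m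
  have hXY : Y ≤ X := by
    rw [hX, ← htel, mul_sum]
    refine sum_le_sum fun k hk => ?_
    rw [← mul_div_assoc, le_div_iff₀ (by linarith [hL0 k]), mul_comm]
    exact mul_le_mul_of_nonneg_right (hL (mem_range.1 hk).le) (hr0 k)
  have hX' : X * L 0 ≤ L m * m := by
    have : (1 - r m) * L 0 ≤ m := by
      rw [← htel, sum_mul]
      calc _ ≤ ∑ k ∈ range m, (1 : ℝ) := sum_le_sum fun k _ => ?_
        _ = m := by simp
      rw [div_mul_eq_mul_div, div_le_one (by linarith [hL0 k])]
      nlinarith [hr1 k, hL (Nat.zero_le k), hr0 k]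
    rw [hX, mul_assoc]
    exact mul_le_mul_of_nonneg_left this (by linarith)
  have hY : m * r m ≤ Y := by
    calc (m : ℝ) * r m = ∑ k ∈ range m, r m := by simp
      _ ≤ Y := sum_le_sum fun k hk => hanti (mem_range.1 hk).le
  have hm' : (1 : ℝ) ≤ m := by exact_mod_cast hm
  -- This is the condition μ > 0 after clearing the denominator 2 + X - Y. To leading order, with
  -- equal lengths L, it reads s(m+1) < L(m-1).
  have hmain : s * (r m + X) < L m * (r m + Y - 2) := by
    have e1 : L m * (m - 1) - (m + 1) * X ≤ L m * (r m + Y - 2) := by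
      rw [hX]; nlinarith
    have e2 : s * (r m + X) ≤ s * (1 + X) := by
      exact mul_le_mul_of_nonneg_left (by linarith [hr1 m]) hs
    have e3 : s + (s + (m + 1)) * X < L m * (m - 1) := by
      have hp : 0 < L 0 := by linarith
      refine lt_of_mul_lt_mul_right (a := L 0) ?_ hp.le
      have : L m * (s * (m + 1) + (m + 1) * m) < L m * (L 0 * (m - 1)) :=
        mul_lt_mul_of_pos_left h (by linarith)
      have h3 : (s + (m + 1)) * (X * L 0) ≤ (s + (m + 1)) * (L m * m) :=
        mul_le_mul_of_nonneg_left hX' (by linarith)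
      have h4 : s * L 0 ≤ s * L m := mul_le_mul_of_nonneg_left (hL (Nat.zero_le m)) hs
      linarith
    linarith
  have hD : 0 < 2 + X - Y := by linarith
  -- The value of t is forced by Σ a_k L_k = s + 2t, the last weight being determined by total
  -- weight 1.
  set t := (L m - s) / (2 + X - Y)
  have ht : t * (2 + X - Y) = L m - s := div_mul_cancel₀ _ hD.ne'
  set a : ℕ → ℝ := fun k => if k < m then t * (r k / L k) else 1 - t * (1 - r m)
  have ha : ∀ k < m, a k = t * (r k / L k) := fun k hk => if_pos hk
  have ham : a m = 1 - t * (1 - r m) := if_neg (lt_irrefl m)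
  have hsum : ∀ j ≤ m, ∑ k ∈ range j, a k = t * (1 - r j) := fun j hj => by
    rw [← htel, mul_sum]
    exact sum_congr rfl fun k hk => ha k ((mem_range.1 hk).trans_le hj)
  have haL : ∀ k < m, a k * L k = t * r k := fun k hk => by
    have := hL0 k
    rw [ha k hk, mul_assoc, div_mul_cancel₀ _ (by linarith)]
  have hS : ∑ k ∈ range (m + 1), a k * L k = s + 2 * t := by
    rw [sum_range_succ, sum_congr rfl fun k hk => haL k (mem_range.1 hk), ← mul_sum, ham]
    change t * Y + _ = _
    have : t * X = t * (L m * (1 - r m)) := rfl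
    linarith
  refine ⟨a, t * r m - a m * L m, ?_, ?_, fun j hj => ?_⟩
  · rw [ham]
    have : (t * r m - (1 - t * (1 - r m)) * L m) * (2 + X - Y)
        = (L m - s) * (r m + X) - L m * (2 + X - Y) := by
      rw [← ht, hX]; ring
    refine pos_of_mul_pos_left ?_ hD.le
    rw [this]; linarith
  · rw [sum_range_succ, hsum m le_rfl, ham]; ring
  · rw [hS, hsum j hj]
    rcases hj.lt_or_eq with hj | rfl
    · rw [haL j hj, if_neg hj.ne]; ring
    · rw [if_pos rfl]; ring

/-- Pairwise coprime lengths with prescribed ratios. -/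
theorem exists_coprime_lengths (d : ℕ) (hd : 3 ≤ d) (β : ℝ) (hβ : (d : ℝ) / ((d : ℝ) - 2) < β) :
    ∃ (s : ℕ) (L : ℕ → ℕ), 0 < s ∧ Monotone L ∧ (∀ k, s < L k) ∧
      (∀ k < d, (L k : ℝ) ≤ β * s) ∧ (∀ k < d, Nat.Coprime s (L k)) ∧
      (∀ i < d, ∀ j < d, i ≠ j → Nat.Coprime (L i) (L j)) ∧
      (s : ℝ) * d + d * (d - 1) < L 0 * (d - 2) := by
  have hd' : (3 : ℝ) ≤ d := by exact_mod_cast hd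
  -- With this a, the interval from da/(d-2) to βa has length at least d, leaving room for the d
  -- numerators b, …, b+d-1.
  obtain ⟨a, ha⟩ := exists_nat_ge ((d : ℝ) / (β - d / (d - 2)))
  rw [div_le_iff₀ (by linarith)] at ha
  have hβ1 : 1 ≤ β := by
    refine le_trans ?_ hβ.le
    rw [le_div_iff₀ (by linarith)]; linarith
  set b := ⌊(d : ℝ) * a / (d - 2)⌋₊ + 1
  have hb1 : (d : ℝ) * a / (d - 2) < b := by
    simpa [b] using Nat.lt_floor_add_one ((d : ℝ) * a / (d - 2))
  have hb2 : (b : ℝ) ≤ d * a / (d - 2) + 1 := by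
    simp only [b]; push_cast
    gcongr
    exact Nat.floor_le (div_nonneg (by positivity) (by linarith))
  rw [div_lt_iff₀ (by linarith)] at hb1
  have hab : a < b := by
    have : (a : ℝ) < b := by
      have : (0 : ℝ) ≤ a := by positivity
      nlinarith
    exact_mod_cast this
  have hb3 : d * a + 2 * b + 1 ≤ b * d := by
    have : (d * a + 2 * b : ℝ) < b * d := by linarith
    exact_mod_cast this
  -- Every difference of two multipliers divides the factorial N, so the numbers xN + 1 are pairwise
  -- coprime. The d² in the argument makes N large enough to absorb the lower-order term d(d-1).
  set N := (b + d ^ 2 + d + 3).factorial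
  have hN : d ^ 2 + 3 ≤ N := le_trans (by omega) (Nat.self_le_factorial _)
  have hcop : ∀ x y, x < y → y ≤ b + d → Nat.Coprime (x * N + 1) (y * N + 1) := fun x y hxy hy =>
    Nat.coprime_mul_succ (Nat.dvd_factorial (by omega) (by omega))
  refine ⟨a * N + 1, fun k => (b + k) * N + 1, Nat.succ_pos _, ?_, ?_, ?_, ?_, ?_, ?_⟩
  · intro i j hij
    dsimp only
    gcongr
  · intro k
    have : a * N < (b + k) * N := Nat.mul_lt_mul_of_pos_right (by omega) (by omega)
    change a * N + 1 < (b + k) * N + 1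
    omega
  · intro k hk
    push_cast
    have hk' : (k : ℝ) + 1 ≤ d := by exact_mod_cast hk
    have h1 : (b : ℝ) + k ≤ β * a := by
      have : (d : ℝ) / (d - 2) * a = d * a / (d - 2) := by ring
      linarith
    have : ((b : ℝ) + k) * N ≤ β * a * N := by gcongr
    linarith
  · intro k hk
    exact hcop _ _ (by omega) (by omega)
  · intro i hi j hj hij
    rcases lt_or_gt_of_ne hij with h | h
    · exact hcop _ _ (by omega) (by omega)
    · exact (hcop _ _ (by omega) (by omega)).symm
  · push_cast
    have h1 : (d : ℝ) * a + 2 * b + 1 ≤ b * d := by exact_mod_cast hb3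
    have h2 : (d : ℝ) ^ 2 + 3 ≤ N := by exact_mod_cast hN
    have h3 : ((d : ℝ) * a + 2 * b + 1) * N ≤ b * d * N := by gcongr
    nlinarith

end

/-! ### The partition by regionwise grids -/

theorem Box.pixel_toSet_subset {R : Box d} {z : Fin d → ℤ} (h : ∀ i, R.lo i ≤ z i ∧ z i < R.hi i) :
    (Box.pixel z).toSet ⊆ R.toSet := by
  intro x hx i
  have h1 : (R.lo i : ℝ) ≤ z i := by exact_mod_cast (h i).1
  have h2 : (z i : ℝ) + 1 ≤ R.hi i := by exact_mod_cast (h i).2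
  have := hx i
  simp only [Box.pixel, Int.cast_add, Int.cast_one] at this
  exact ⟨by linarith, by linarith⟩

theorem Box.interior_toSet_subset (R : Box d) :
    interior R.toSet ⊆ {x | ∀ i, (R.lo i : ℝ) < x i ∧ x i < R.hi i} := by
  intro x hx i
  have hc : Continuous fun t : ℝ => x + t • EuclideanSpace.single i (1 : ℝ) := by fun_prop
  have h0 : (0 : ℝ) ∈ (fun t : ℝ => x + t • EuclideanSpace.single i (1 : ℝ)) ⁻¹' interior R.toSet := by
    simpa using hx
  obtain ⟨δ, hδ, hball⟩ := Metric.isOpen_iff.1 (isOpen_interior.preimage hc) 0 h0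
  have h1 := interior_subset (hball (show δ / 2 ∈ Metric.ball (0 : ℝ) δ by
    rw [Metric.mem_ball, Real.dist_eq, sub_zero, abs_of_pos (by positivity)]; linarith)) i
  have h2 := interior_subset (hball (show -(δ / 2) ∈ Metric.ball (0 : ℝ) δ by
    rw [Metric.mem_ball, Real.dist_eq, sub_zero, abs_neg, abs_of_pos (by positivity)]
    linarith)) i
  simp at h1 h2
  exact ⟨by linarith, by linarith⟩

/-- The first coordinate in which `z` is not below `o`, or `d` if there is none. -/
noncomputable def firstAbove (o z : Fin d → ℤ) : ℕ :=
  sInf {k | ∀ h : k < d, o ⟨k, h⟩ ≤ z ⟨k, h⟩}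

theorem firstAbove_eq {o z : Fin d → ℤ} {k : ℕ} (h1 : ∀ j : Fin d, (j : ℕ) < k → z j < o j)
    (h2 : ∀ h : k < d, o ⟨k, h⟩ ≤ z ⟨k, h⟩) (hk : k ≤ d) : firstAbove o z = k := by
  refine le_antisymm (Nat.sInf_le h2) (le_csInf ⟨k, h2⟩ fun j hj => ?_)
  by_contra! hlt
  exact absurd (hj (by omega)) (not_le.2 (h1 ⟨j, by omega⟩ hlt))

theorem firstAbove_spec (o z : Fin d → ℤ) : firstAbove o z ≤ d ∧
    (∀ j : Fin d, (j : ℕ) < firstAbove o z → z j < o j) ∧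
    ∀ h : firstAbove o z < d, o ⟨_, h⟩ ≤ z ⟨_, h⟩ := by
  have hd : d ∈ {k | ∀ h : k < d, o ⟨k, h⟩ ≤ z ⟨k, h⟩} := fun h => absurd h (lt_irrefl d)
  refine ⟨Nat.sInf_le hd, fun j hj => ?_, Nat.sInf_mem ⟨d, hd⟩⟩
  by_contra! hle
  exact Nat.notMem_of_lt_sInf hj fun _ => hle

/-- The box containing the pixel `z` when the pixels with first coordinate above `o` equal to `k`
are grouped along the grid of mesh `L k`. -/
noncomputable def gridCell (o : Fin d → ℤ) (L : ℕ → ℕ) (hL : ∀ k, 0 < L k) (z : Fin d → ℤ) :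
    Box d where
  lo j := L (firstAbove o z) * (z j / L (firstAbove o z))
  hi j := L (firstAbove o z) * (z j / L (firstAbove o z)) + L (firstAbove o z)
  lo_lt_hi j := by have := hL (firstAbove o z); omega

section
variable (o : Fin d → ℤ) (L : ℕ → ℕ) (hL : ∀ k, 0 < L k)

theorem mem_gridCell (z : Fin d → ℤ) (j : Fin d) :
    (gridCell o L hL z).lo j ≤ z j ∧ z j < (gridCell o L hL z).hi j := by
  have h0 : (0 : ℤ) < L (firstAbove o z) := by exact_mod_cast hL _
  exact ⟨Int.mul_ediv_self_le h0.ne', Int.lt_mul_ediv_self_add h0⟩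

theorem gridCell_length (z : Fin d → ℤ) (j : Fin d) :
    (gridCell o L hL z).length j = L (firstAbove o z) := by
  simp [gridCell, Box.length]

/-- The planes x_j = o_j with j ≤ k, which bound region k, are planes of the grid of mesh L_k. No
cell straddles them, so all pixels of a cell lie in one region and produce the same cell. -/
theorem gridCell_eq_of_mem (hdiv : ∀ k ≤ d, ∀ j : Fin d, (j : ℕ) ≤ k → (L k : ℤ) ∣ o j)
    {z z' : Fin d → ℤ}
    (h : ∀ j, (gridCell o L hL z).lo j ≤ z' j ∧ z' j < (gridCell o L hL z).hi j) :
    gridCell o L hL z' = gridCell o L hL z := by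
  obtain ⟨hk, h1, h2⟩ := firstAbove_spec o z
  have h0 : (0 : ℤ) < L (firstAbove o z) := by exact_mod_cast hL _
  have hq : ∀ j, z' j / L (firstAbove o z) = z j / L (firstAbove o z) := fun j => by
    have := h j
    simp only [gridCell] at this
    rw [Int.ediv_eq_iff_of_pos h0]
    constructor <;> linarith
  have hiff : ∀ j : Fin d, (j : ℕ) ≤ firstAbove o z → (o j ≤ z' j ↔ o j ≤ z j) := fun j hj => by
    obtain ⟨m, hm⟩ := hdiv _ hk j hj
    rw [hm, mul_comm, ← Int.le_ediv_iff_mul_le h0, ← Int.le_ediv_iff_mul_le h0, hq]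
  have hf : firstAbove o z' = firstAbove o z := by
    refine firstAbove_eq (fun j hj => ?_) (fun h => (hiff ⟨_, h⟩ le_rfl).2 (h2 h)) hk
    exact lt_of_not_ge fun hle => not_le.2 (h1 j hj) ((hiff j hj.le).1 hle)
  ext j <;> simp only [gridCell, hf, hq]

/-- The partition of `[0, n]^d` into grid cells. -/
noncomputable def gridPartition (n : ℕ) : Finset (Box d) := by
  classical
  exact (Fintype.piFinset fun _ : Fin d => Finset.Ico (0 : ℤ) n).image (gridCell o L hL)

theorem mem_gridPartition {n : ℕ} {R : Box d} : R ∈ gridPartition o L hL n ↔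
    ∃ z : Fin d → ℤ, (∀ j, 0 ≤ z j ∧ z j < n) ∧ gridCell o L hL z = R := by
  classical
  simp [gridPartition]

theorem isCubical_gridPartition (n : ℕ) : IsCubical (gridPartition o L hL n) := by
  intro R hR i j
  obtain ⟨z, -, rfl⟩ := (mem_gridPartition o L hL).1 hR
  simp only [gridCell_length]

theorem isPartition_gridPartition {n : ℕ} (hn0 : 0 < n) (hn : ∀ k ≤ d, L k ∣ n)
    (hdiv : ∀ k ≤ d, ∀ j : Fin d, (j : ℕ) ≤ k → (L k : ℤ) ∣ o j) :
    IsPartition n (gridPartition o L hL n) where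
  iUnion_eq := by
    ext x
    simp only [Set.mem_iUnion, exists_prop, mem_gridPartition]
    constructor
    · rintro ⟨_, ⟨z, hz, rfl⟩, hx⟩ j
      have h0 : (0 : ℤ) < L (firstAbove o z) := by exact_mod_cast hL _
      obtain ⟨q, hq⟩ := hn _ (firstAbove_spec o z).1
      have hlo : 0 ≤ (gridCell o L hL z).lo j :=
        mul_nonneg h0.le (Int.ediv_nonneg (hz j).1 h0.le)
      have hhi : (gridCell o L hL z).hi j ≤ n := by
        simp only [gridCell]
        have hlt : z j / L (firstAbove o z) < q := by
          rw [Int.ediv_lt_iff_lt_mul h0]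
          have := (hz j).2
          rw [hq] at this
          push_cast at this
          linarith
        rw [hq]
        push_cast
        nlinarith
      have hlo' : (0 : ℝ) ≤ (gridCell o L hL z).lo j := by exact_mod_cast hlo
      have hhi' : ((gridCell o L hL z).hi j : ℝ) ≤ n := by exact_mod_cast hhi
      exact ⟨hlo'.trans (hx j).1, (hx j).2.trans hhi'⟩
    · intro hx
      -- The minimum with n - 1 handles points on the far faces x_j = n.
      set z : Fin d → ℤ := fun j => min ⌊x j⌋ (n - 1)
      refine ⟨_, ⟨z, fun j => ⟨le_min (Int.floor_nonneg.2 (hx j).1) (by omega), ?_⟩, rfl⟩,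
        Box.pixel_toSet_subset (mem_gridCell o L hL z) fun j => ⟨?_, ?_⟩⟩
      · have := min_le_right ⌊x j⌋ ((n : ℤ) - 1)
        simp only [z]; omega
      · refine le_trans ?_ (Int.floor_le (x j))
        exact_mod_cast min_le_left _ _
      · simp only [Box.pixel, z]
        rcases min_choice ⌊x j⌋ ((n : ℤ) - 1) with h | h <;> rw [h]
        · push_cast; exact (Int.lt_floor_add_one (x j)).le
        · push_cast; linarith [(hx j).2]
  disjoint := by
    intro R hR R' hR' hne
    obtain ⟨z, -, rfl⟩ := (mem_gridPartition o L hL).1 hR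
    obtain ⟨z', -, rfl⟩ := (mem_gridPartition o L hL).1 hR'
    rw [Set.disjoint_left]
    intro x hx hx'
    -- An interior point satisfies strict bounds, so its floor pixel lies in every cell having it in
    -- the interior; this pixel identifies the cell.
    have key : ∀ v, x ∈ interior (gridCell o L hL v).toSet →
        gridCell o L hL (fun j => ⌊x j⌋) = gridCell o L hL v := fun v hv =>
      gridCell_eq_of_mem o L hL hdiv fun j => by
        have := Box.interior_toSet_subset _ hv j
        exact ⟨Int.le_floor.2 this.1.le, Int.floor_lt.2 this.2⟩
    exact hne ((key z hx).symm.trans (key z' hx'))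

/-- All side lengths in the partition lie in [s, βs], so which cells actually meet is irrelevant. -/
theorem isBalanced_gridPartition (n : ℕ) (hd : 0 < d) (ε β s : ℝ) (hs : 0 < s)
    (h : ∀ k ≤ d, s ≤ L k ∧ (L k : ℝ) ≤ β * s) : IsBalanced ε β (gridPartition o L hL n) := by
  rintro σ ⟨⟨R, hR⟩, hσ, -⟩
  set A := {l : ℝ | ∃ R ∈ σ, ∃ i, R.length i = l}
  have hne : A.Nonempty := ⟨_, R, hR, ⟨0, hd⟩, rfl⟩
  have hA : ∀ l ∈ A, s ≤ l ∧ l ≤ β * s := by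
    rintro _ ⟨R, hR, i, rfl⟩
    obtain ⟨z, -, rfl⟩ := (mem_gridPartition o L hL).1 (hσ hR)
    rw [gridCell_length]
    exact h _ (firstAbove_spec o z).1
  have h1 : sSup A ≤ β * s := csSup_le hne fun l hl => (hA l hl).2
  have h2 : s ≤ sInf A := le_csInf hne fun l hl => (hA l hl).1
  have hβ : 0 ≤ β := by
    obtain ⟨l, hl⟩ := hne
    have := hA l hl
    by_contra! hneg
    nlinarith
  change sSup A / sInf A ≤ β
  rw [div_le_iff₀ (by linarith)]
  exact h1.trans (mul_le_mul_of_nonneg_left h2 hβ)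

end
-- Cells around the corner and the failure of embeddability
section
variable (o : Fin d → ℤ) (L : ℕ → ℕ) (hL : ∀ k, 0 < L k)

theorem gridCell_center_apply {z : Fin d → ℤ} {k : ℕ} {j : Fin d} {t : ℤ}
    (hk : firstAbove o z = k) (ht : (L k : ℤ) ∣ t) (h1 : t ≤ z j) (h2 : z j < t + L k) :
    (gridCell o L hL z).center j = t + (L k : ℝ) / 2 := by
  have h0 : (0 : ℤ) < L k := by exact_mod_cast hL _
  obtain ⟨q, rfl⟩ := ht
  have hq : z j / L k = q := by
    rw [Int.ediv_eq_iff_of_pos h0]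
    constructor <;> linarith
  simp only [Box.center, gridCell, hk, hq]
  push_cast
  ring

theorem mem_distortedBox_gridCell {ε : ℝ} {z : Fin d → ℤ} {x : EuclideanSpace ℝ (Fin d)}
    (hx : x ∈ distortedPixel ε z) : x ∈ distortedBox ε (gridCell o L hL z) :=
  ⟨z, Box.pixel_toSet_subset (mem_gridCell o L hL z), hx⟩

/-- A family of grid cells, together with one more, is a simplex if their pixels share a point. -/
theorem insert_gridCell_mem_faces [DecidableEq (Box d)] {ι : Type*} [Fintype ι] {ε : ℝ} {n : ℕ}
    {v : ι → Fin d → ℤ} {u : Fin d → ℤ} {x : EuclideanSpace ℝ (Fin d)}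
    (hv : ∀ i j, 0 ≤ v i j ∧ v i j < n) (hu : ∀ j, 0 ≤ u j ∧ u j < n)
    (hxv : ∀ i, x ∈ distortedPixel ε (v i)) (hxu : x ∈ distortedPixel ε u) :
    insert (gridCell o L hL u) (Finset.univ.image fun i => gridCell o L hL (v i)) ∈
      (dualComplex ε (gridPartition o L hL n)).faces := by
  refine ⟨Finset.insert_nonempty _ _, ?_, x, ?_⟩
  · intro R hR
    simp only [Finset.mem_insert, Finset.mem_image, Finset.mem_univ, true_and] at hR
    rcases hR with rfl | ⟨i, rfl⟩
    · exact (mem_gridPartition o L hL).2 ⟨u, hu, rfl⟩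
    · exact (mem_gridPartition o L hL).2 ⟨v i, hv i, rfl⟩
  · simp only [Set.mem_iInter, Finset.mem_insert, Finset.mem_image, Finset.mem_univ, true_and]
    rintro R (rfl | ⟨i, rfl⟩)
    · exact mem_distortedBox_gridCell o L hL hxu
    · exact mem_distortedBox_gridCell o L hL (hxv i)

end

/-- The pixels around the corner `o`: the first `k` coordinates are below `o`. -/
def chainPixel (o : Fin d → ℤ) (k : ℕ) (j : Fin d) : ℤ := if (j : ℕ) < k then o j - 1 else o j

theorem firstAbove_chainPixel (o : Fin d → ℤ) {k : ℕ} (hk : k ≤ d) :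
    firstAbove o (chainPixel o k) = k :=
  firstAbove_eq (fun j hj => by simp [chainPixel, hj]) (fun h => by simp [chainPixel]) hk

/-- The cell ends at o_j for j < k, starts at o_j for j = k, and ends at o_j + 1 for j > k; the last
case is the source of the unit offset. -/
theorem center_gridCell_chainPixel (o : Fin d → ℤ) (L : ℕ → ℕ) (hL : ∀ k, 0 < L k) {k : ℕ}
    (hk : k ≤ d) (hdiv : ∀ j : Fin d, (j : ℕ) ≤ k → (L k : ℤ) ∣ o j)
    (hdiv' : ∀ j : Fin d, k < j → (L k : ℤ) ∣ o j + 1) (j : Fin d) :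
    (gridCell o L hL (chainPixel o k)).center j =
      o j - (L k : ℝ) / 2 + (if k = j then (L k : ℝ) else 0) + if k < j then 1 else 0 := by
  have h0 : (0 : ℤ) < L k := by exact_mod_cast hL k
  have hf := firstAbove_chainPixel o hk
  rcases lt_trichotomy (j : ℕ) k with h | h | h
  · rw [gridCell_center_apply o L hL (t := o j - L k) hf ((hdiv j h.le).sub dvd_rfl)
      (by simp only [chainPixel, h, if_true]; omega) (by simp only [chainPixel, h, if_true]; omega),
      if_neg h.ne', if_neg h.not_gt]
    push_cast; ring
  · rw [gridCell_center_apply o L hL (t := o j) hf (hdiv j h.le)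
      (by simp only [chainPixel, h, lt_irrefl, if_false]; omega)
      (by simp only [chainPixel, h, lt_irrefl, if_false]; omega),
      if_pos h.symm, if_neg h.not_gt]
    ring
  · rw [gridCell_center_apply o L hL (t := o j + 1 - L k) hf ((hdiv' j h).sub dvd_rfl)
      (by simp only [chainPixel, h.not_gt, if_false]; omega)
      (by simp only [chainPixel, h.not_gt, if_false]; omega),
      if_neg h.ne, if_pos h]
    push_cast; ring

theorem not_centerEmbeddable_gridPartition {m : ℕ} (hm : 1 ≤ m) (o : Fin (m + 1) → ℤ) (L : ℕ → ℕ)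
    (hL : ∀ k, 0 < L k) {n : ℕ} {ε : ℝ} (hε0 : 0 < ε) (hε : ε * ((m + 1 : ℕ) : ℝ) < 2)
    (ho : ∀ j, 1 ≤ o j ∧ o j + 1 < n)
    (hdiv : ∀ k ≤ m + 1, ∀ j : Fin (m + 1), (j : ℕ) ≤ k → (L k : ℤ) ∣ o j)
    (hdiv' : ∀ k ≤ m + 1, ∀ j : Fin (m + 1), k < j → (L k : ℤ) ∣ o j + 1)
    (hne : ∀ k ≤ m, L k ≠ L (m + 1))
    (a : ℕ → ℝ) (μ : ℝ) (hμ : 0 ≤ μ) (ha : ∑ k ∈ Finset.range (m + 1), a k = 1)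
    (haL : ∀ j ≤ m, -(L (m + 1) : ℝ) / 2 = -(∑ k ∈ Finset.range (m + 1), a k * L k) / 2
      + a j * L j + ∑ k ∈ Finset.range j, a k + if j = m then μ else 0) :
    ¬ CenterEmbeddable ε (gridPartition o L hL n) := by
  classical
  -- The pixel just past the region-0 corner cell in the last direction, where that cell ends at o_m
  -- + 1; its cell is Q.
  set u : Fin (m + 1) → ℤ := fun j => if (j : ℕ) = m then o j + 1 else o j
  have hL0 : (0 : ℝ) < L 0 := by exact_mod_cast hL 0
  have hu0 : firstAbove o u = 0 :=
    firstAbove_eq (fun j hj => absurd hj (Nat.not_lt_zero _))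
      (fun h => by simp only [u]; split_ifs <;> simp) (Nat.zero_le _)
  have hcu : ∀ j, (gridCell o L hL u).center j =
      (gridCell o L hL (chainPixel o 0)).center j + if (j : ℕ) = m then (L 0 : ℝ) else 0 := by
    intro j
    have h0 : (0 : ℤ) < L 0 := by exact_mod_cast hL 0
    rw [center_gridCell_chainPixel o L hL (Nat.zero_le _) (hdiv 0 (Nat.zero_le _))
      (hdiv' 0 (Nat.zero_le _))]
    rcases Nat.eq_zero_or_pos (j : ℕ) with h | h
    · rw [gridCell_center_apply o L hL (t := o j) hu0 (hdiv 0 (Nat.zero_le _) j h.le)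
        (by simp only [u]; split_ifs <;> omega)
        (by simp only [u]; rw [if_neg (by omega)]; omega)]
      rw [if_pos h.symm, if_neg (by omega), if_neg (by omega)]
      ring
    · by_cases hj : (j : ℕ) = m
      · rw [gridCell_center_apply o L hL (t := o j + 1) hu0 (hdiv' 0 (Nat.zero_le _) j h)
          (by simp only [u]; rw [if_pos hj]) (by simp only [u]; rw [if_pos hj]; omega)]
        rw [if_neg h.ne, if_pos h, if_pos hj]
        push_cast; ring
      · rw [gridCell_center_apply o L hL (t := o j + 1 - L 0) hu0
          ((hdiv' 0 (Nat.zero_le _) j h).sub dvd_rfl)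
          (by simp only [u]; rw [if_neg hj]; omega) (by simp only [u]; rw [if_neg hj]; omega)]
        rw [if_neg h.ne, if_pos h, if_neg hj]
        push_cast; ring
  have hpix : ∀ k j, 0 ≤ chainPixel o k j ∧ chainPixel o k j < n := fun k j => by
    have := ho j
    simp only [chainPixel]
    split_ifs <;> omega
  have hupix : ∀ j, 0 ≤ u j ∧ u j < n := fun j => by
    have := ho j
    simp only [u]
    split_ifs <;> omega
  -- The small cube differs from the other cells by its side length.
  have hlen : ∀ z, firstAbove o z ≤ m →
      gridCell o L hL (chainPixel o (m + 1)) ≠ gridCell o L hL z := fun z hz h => by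
    have h1 := gridCell_length o L hL z 0
    rw [← h, gridCell_length, firstAbove_chainPixel o le_rfl] at h1
    exact hne _ hz (by exact_mod_cast h1.symm)
  -- Since Q - B₀ = L₀ e_m on centers, the term μ e_m becomes (μ/L₀)(Q - B₀), which corrects the
  -- weight of B₀.
  refine not_isEmbeddingOf_of_overlap _ Box.center
    (fun i : Fin (m + 1) => gridCell o L hL (chainPixel o i))
    (gridCell o L hL (chainPixel o (m + 1))) (gridCell o L hL u) ?_ ?_
    (hlen u (by omega))
    (fun i => (hlen _ (by rw [firstAbove_chainPixel o (by omega)]; omega)).symm)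
    (fun i => a i - if (i : ℕ) = 0 then μ / L 0 else 0) (μ / L 0) (by positivity) ?_ ?_
  · obtain ⟨x, hx⟩ := exists_forall_mem_distortedPixel hε0 hε (fun j => o j - 1)
      (fun j => (j : ℕ)) (fun i j h => by simpa [Fin.ext_iff] using h)
    have hc : ∀ k, x ∈ distortedPixel ε (chainPixel o k) := fun k => by
      refine hx _ (fun i => ?_) (fun i j hij => ?_)
      · simp only [chainPixel]; split_ifs <;> simp
      · simp only [chainPixel]; split_ifs <;> omega
    exact insert_gridCell_mem_faces o L hL (fun _ => hpix _) (hpix _) (fun _ => hc _) (hc _)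
  -- This chain is the previous one without its lowest pixel and with u added on top: it starts at
  -- `chainPixel o m` and raises the last coordinate last, hence its rank -1.
  · obtain ⟨x, hx⟩ := exists_forall_mem_distortedPixel hε0 hε
      (fun j => if (j : ℕ) = m then o j else o j - 1)
      (fun j => if (j : ℕ) = m then -1 else (j : ℕ)) (fun i j h => by
        dsimp only at h
        ext
        split_ifs at h <;> omega)
    refine insert_gridCell_mem_faces o L hL (x := x) (fun _ => hpix _) hupix (fun k => ?_) ?_
    · refine hx _ (fun i => ?_) (fun i j hij => ?_)
      · simp only [chainPixel]; split_ifs <;> omega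
      · simp only [chainPixel]
        split_ifs at hij ⊢ <;> omega
    · refine hx _ (fun i => ?_) (fun i j hij => ?_)
      · simp only [u]; split_ifs <;> simp
      · simp only [u]
        split_ifs <;> omega
  · rw [Finset.sum_sub_distrib, Fin.sum_univ_eq_sum_range a, ha,
      Fin.sum_univ_eq_sum_range (fun i => if i = 0 then μ / (L 0 : ℝ) else 0)]
    simp
  · ext j
    have hjm : (j : ℕ) ≤ m := Nat.lt_succ_iff.1 j.2
    simp only [PiLp.add_apply, PiLp.smul_apply, WithLp.ofLp_sum, Finset.sum_apply, smul_eq_mul,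
      WithLp.ofLp_smul, Pi.smul_apply, hcu]
    set c0 := (gridCell o L hL (chainPixel o 0)).center j
    have hsum : ∑ i : Fin (m + 1), (a i - if (i : ℕ) = 0 then μ / (L 0 : ℝ) else 0) *
        (gridCell o L hL (chainPixel o i)).center j
        = ∑ k ∈ Finset.range (m + 1), a k * (gridCell o L hL (chainPixel o k)).center j
          - μ / L 0 * c0 := by
      rw [Fin.sum_univ_eq_sum_range (fun i => (a i - if i = 0 then μ / (L 0 : ℝ) else 0) *
        (gridCell o L hL (chainPixel o i)).center j)]
      simp only [sub_mul, Finset.sum_sub_distrib, ite_mul, zero_mul, Finset.sum_ite_eq',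
        Finset.mem_range, Nat.succ_pos, if_true]
      simp [c0]
    have hsum' : ∑ k ∈ Finset.range (m + 1), a k * (gridCell o L hL (chainPixel o k)).center j
        = o j - (∑ k ∈ Finset.range (m + 1), a k * L k) / 2 + a j * L j
          + ∑ k ∈ Finset.range j, a k := by
      have hterm : ∀ k ∈ Finset.range (m + 1),
          a k * (gridCell o L hL (chainPixel o k)).center j = a k * o j - a k * L k / 2
            + (if k = (j : ℕ) then a k * L k else 0) + if k < (j : ℕ) then a k else 0 := by
        intro k hk
        have hk' : k ≤ m + 1 := (Finset.mem_range.1 hk).le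
        rw [center_gridCell_chainPixel o L hL hk' (hdiv k hk') (hdiv' k hk')]
        split_ifs <;> ring
      have hfil : (Finset.range (m + 1)).filter (fun k => k < (j : ℕ)) = Finset.range j := by
        ext k
        simp only [Finset.mem_filter, Finset.mem_range]
        omega
      rw [Finset.sum_congr rfl hterm, Finset.sum_add_distrib, Finset.sum_add_distrib,
        Finset.sum_sub_distrib, ← Finset.sum_mul, ha, ← Finset.sum_div, Finset.sum_ite_eq',
        if_pos (Finset.mem_range.2 j.2), ← Finset.sum_filter, hfil, one_mul]
    rw [hsum, hsum', center_gridCell_chainPixel o L hL le_rfl (hdiv _ le_rfl) (hdiv' _ le_rfl),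
      if_neg (by omega), if_neg (by omega)]
    have := haL j hjm
    have hdvd : μ / L 0 * L 0 = μ := div_mul_cancel₀ _ hL0.ne'
    split_ifs at this ⊢ <;> linarith

/-! ### Choice of the corner and conclusion -/

/-- A corner whose coordinates have prescribed residues modulo pairwise coprime lengths. -/
theorem exists_corner (d : ℕ) (L : ℕ → ℕ) (hL : ∀ k, 0 < L k)
    (hco : ∀ i ≤ d, ∀ j ≤ d, i ≠ j → Nat.Coprime (L i) (L j)) :
    ∃ (n : ℕ) (o : Fin d → ℤ), 0 < n ∧ (∀ k ≤ d, L k ∣ n) ∧ (∀ j, 1 ≤ o j ∧ o j + 1 < n) ∧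
      (∀ k ≤ d, ∀ j : Fin d, (j : ℕ) ≤ k → (L k : ℤ) ∣ o j) ∧
      (∀ k ≤ d, ∀ j : Fin d, k < j → (L k : ℤ) ∣ o j + 1) := by
  set P := ∏ k ∈ Finset.range (d + 1), L k
  have hP : 0 < P := Finset.prod_pos fun k _ => hL k
  have hdP : ∀ k ≤ d, L k ∣ P := fun k hk =>
    Finset.dvd_prod_of_mem _ (Finset.mem_range.2 (Nat.lt_succ_of_le hk))
  have hcrt : ∀ j : Fin d, ∃ x : ℕ, ∀ k ≤ d, x ≡ (if (j : ℕ) ≤ k then 0 else L k - 1) [MOD L k] :=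
    fun j => by
      obtain ⟨x, hx⟩ := Nat.chineseRemainderOfFinset
        (fun k => if (j : ℕ) ≤ k then 0 else L k - 1) L (Finset.range (d + 1))
        (fun k _ => (hL k).ne') (fun i hi k hk hik => by
          simp only [Finset.coe_range, Set.mem_Iio] at hi hk
          exact hco i (by omega) k (by omega) hik)
      exact ⟨x, fun k hk => hx k (Finset.mem_range.2 (Nat.lt_succ_of_le hk))⟩
  choose x hx using hcrt
  have hmod : ∀ (j : Fin d) (k : ℕ), k ≤ d → (L k : ℤ) ∣ ((x j % P : ℕ) : ℤ) - x j := fun j k hk => by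
    have h1 : x j % P ≡ x j [MOD L k] := (Nat.mod_modEq _ _).of_dvd (hdP k hk)
    exact (Nat.modEq_iff_dvd.1 h1.symm)
  have hdP' : ∀ k ≤ d, (L k : ℤ) ∣ (P : ℤ) := fun k hk => Int.natCast_dvd_natCast.2 (hdP k hk)
  -- Reducing modulo P and adding P keeps all residues and puts each coordinate in [P, 2P), which
  -- leaves the required margin inside [0, 3P].
  refine ⟨3 * P, fun j => (x j % P : ℕ) + P, by omega, fun k hk => (hdP k hk).mul_left 3,
    fun j => ?_, fun k hk j hjk => ?_, fun k hk j hjk => ?_⟩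
  · have := Nat.mod_lt (x j) hP
    dsimp only
    omega
  · have h := hx j k hk
    rw [if_pos hjk] at h
    have h' : (L k : ℤ) ∣ x j := Int.natCast_dvd_natCast.2 ((Nat.modEq_zero_iff_dvd).1 h)
    have := (((hmod j k hk).add h').add (hdP' k hk))
    simpa using this
  · have h := Nat.modEq_iff_dvd.1 (hx j k hk)
    rw [if_neg (by omega), Nat.cast_sub (hL k)] at h
    have := (((hmod j k hk).sub h).add (hdP' k hk)).add (dvd_refl (L k : ℤ))
    have e : ((x j % P : ℕ) : ℤ) + P + 1
        = ((x j % P : ℕ) : ℤ) - x j - ((L k : ℤ) - (1 : ℕ) - x j) + P + L k := by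
      rw [Nat.cast_one]; ring
    exact e ▸ this

end CubicalDual

theorem mainTheorem5 (d : ℕ) (hd : 3 ≤ d) (β : ℝ) (hβ : (d : ℝ) / ((d : ℝ) - 2) < β) :
    ∃ (n : ℕ) (C : Finset (CubicalDual.Box d)),
      0 < n ∧ CubicalDual.IsPartition n C ∧ CubicalDual.IsCubical C ∧
        ∀ ε : ℝ, 0 < ε → ε < 2 / (d : ℝ) →
          CubicalDual.IsBalanced ε β C ∧ ¬ CubicalDual.CenterEmbeddable ε C := by
  open CubicalDual in
  obtain ⟨s, ℓ, hs, hmono, hlt, hle, hcs, hcℓ, hratio⟩ := exists_coprime_lengths d hd β hβ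
  obtain ⟨m, rfl⟩ : ∃ m, d = m + 1 := ⟨d - 1, by omega⟩
  -- Index m + 1 = d is the region below the corner, which receives the small mesh.
  set L : ℕ → ℕ := fun k => if k ≤ m then ℓ k else s
  have hLk : ∀ k ≤ m, L k = ℓ k := fun k hk => if_pos hk
  have hLs : L (m + 1) = s := if_neg (by omega)
  have hL : ∀ k, 0 < L k := fun k => by
    simp only [L]
    split_ifs
    · exact hs.trans (hlt k)
    · exact hs
  have hco : ∀ i ≤ m + 1, ∀ j ≤ m + 1, i ≠ j → Nat.Coprime (L i) (L j) := by
    intro i hi j hj hij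
    simp only [L]
    split_ifs
    · exact hcℓ i (by omega) j (by omega) hij
    · exact (hcs i (by omega)).symm
    · exact hcs j (by omega)
    · omega
  obtain ⟨n, o, hn, hLn, ho, hdiv, hdiv'⟩ := exists_corner (m + 1) L hL hco
  have hs1 : (1 : ℝ) ≤ s := by exact_mod_cast hs
  have hℓ : ∀ k, (s : ℝ) ≤ ℓ k := fun k => by exact_mod_cast (hlt k).le
  obtain ⟨a, μ, hμ, ha, haL⟩ := exists_affine_weights m (fun k => (ℓ k : ℝ)) s (by omega)
    (by linarith) (hs1.trans (hℓ 0)) (fun i j hij => Nat.cast_le.2 (hmono hij)) (by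
      push_cast at hratio
      linarith)
  refine ⟨n, gridPartition o L hL n, hn, isPartition_gridPartition o L hL hn hLn hdiv,
    isCubical_gridPartition o L hL n, fun ε hε0 hε => ⟨?_, ?_⟩⟩
  · refine isBalanced_gridPartition o L hL n (Nat.succ_pos m) ε β s (by linarith) fun k hk => ?_
    have hβ1 : (s : ℝ) ≤ β * s := (hℓ 0).trans (hle 0 (Nat.succ_pos m))
    simp only [L]
    split_ifs
    · exact ⟨hℓ k, hle k (by omega)⟩
    · exact ⟨le_rfl, hβ1⟩
  · rw [lt_div_iff₀ (by positivity)] at hε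
    refine not_centerEmbeddable_gridPartition (by omega) o L hL hε0 hε ho hdiv hdiv'
      (fun k hk => by rw [hLk k hk, hLs]; exact (hlt k).ne') a μ hμ.le ha fun j hj => ?_
    rw [hLs, hLk j hj, haL j hj, Finset.sum_congr rfl fun k hk => by
      rw [← hLk k (Nat.lt_succ_iff.1 (Finset.mem_range.1 hk))]]
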